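/- Let $\Gamma=(V,E)$ be a finite, connected, vertex transitive graph without loops or multiple edges, with adjacency matrix $\epsilon$, let $k\in\mathbb{N}$, and suppose that the diameter of $\Gamma$ is at most $2k+1$. A path of length $\alpha$ is a tuple $(i_1,\dots,i_{\alpha+1})$ of vertices in which consecutive vertices are adjacent. Let $C(\mathbb{G}_k^+(\Gamma))$ be the universal unital $C^*$-algebra generated by self-adjoint elements $q_{ij}$ $(i,j\in V)$ subject to the relations $$\sum_j q_{ij}=1=\sum_j q_{ji},\qquad q_{ij}q_{il}=\delta_{jl}q_{ij},\qquad q_{ji}q_{li}=\delta_{jl}q_{ji},\qquad q\epsilon=\epsilon q,$$ and $q_{i_1j_1}\cdots q_{i_\beta j_\beta}=q_{i_\beta j_\beta}\cdots q_{i_1j_1}$ for all paths $(i_1,\dots,i_\beta)$, $(j_1,\dots,j_\beta)$ with $\beta\le k+1$ vertices. For two paths of the same length write $(i_1,\dots,i_\gamma)\sim^k(j_1,\dots,j_\gamma)$ if $q_{i_1j_1}\cdots q_{i_\gamma j_\gamma}\neq 0$ in $C(\mathbb{G}_k^+(\Gamma))$. In particular this defines $\sim^k$ for edges with a chosen orientation,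 which are the paths of length one. Fix a vertex $i_1$ and a set $\mathcal{S}$ of shortest paths of $\Gamma$ starting at $i_1$ (for instance, one fixed shortest path from $i_1$ to each vertex). For $j_1\in V$ let $\mathcal{P}_k^{j_1}$ be the set of all paths that start at $j_1$ and are $\sim^k$-equivalent to some path in $\mathcal{S}$. For an edge $e$ let $$N_e^k=\#\{p\in\textstyle\bigcup_{j_1\in V}\mathcal{P}_k^{j_1} : e\text{ occurs in }p\}.$$ If $e$ and $f$ are edges with chosen orientations and $e\sim^k f$, then $N_e^k=N_f^k$. This holds both when an edge is said to occur in a path if the path traverses it in either direction, and when it is said to occur only if the path traverses it in its chosen direction. -/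

import Mathlib

open scoped ENNReal

namespace QuantumPaths

section Paths

variable {V : Type*}

/-- The tuple `(p 0, …, p α)` is a path of length `α` in `G`: consecutive vertices are adjacent. -/
def IsPath (G : SimpleGraph V) {α : ℕ} (p : Fin (α + 1) → V) : Prop :=
  ∀ s : Fin α, G.Adj (p s.castSucc) (p s.succ)

/-- A path of arbitrary length, as a tuple of vertices together with its length. -/
abbrev VertexTuple (V : Type*) : Type _ := Σ α : ℕ, Fin (α + 1) → V

/-- `x` is a shortest path of `G` (from its first to its last vertex) that starts at `i₁`. -/
structure IsShortestPathFrom (G : SimpleGraph V) (i₁ : V) (x : VertexTuple V) : Prop where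
  isPath : IsPath G x.2
  start : x.2 0 = i₁
  length_eq : x.1 = G.dist (x.2 0) (x.2 (Fin.last x.1))

/-- The unoriented edge `e` occurs in the path `p`. -/
def EdgeOccurs (e : Sym2 V) {α : ℕ} (p : Fin (α + 1) → V) : Prop :=
  ∃ s : Fin α, s(p s.castSucc, p s.succ) = e

/-- The ordered pair `e` occurs in the path `p`: `p` runs from `e.1` to `e.2` in one step. -/
def OrientedEdgeOccurs (e : V × V) {α : ℕ} (p : Fin (α + 1) → V) : Prop :=
  ∃ s : Fin α, (p s.castSucc, p s.succ) = e

end Paths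

section Relations

variable {V : Type*} {A : Type*}

/-- The list `q_{i₀ j₀}, …, q_{i_α j_α}` of entries of the matrix `q` along two tuples. -/
def entries (q : Matrix V V A) {α : ℕ} (i j : Fin (α + 1) → V) : List A :=
  List.ofFn fun s => q (i s) (j s)

variable [Fintype V] [DecidableEq V] [Ring A] [StarRing A]

/-- The defining relations of the quantum permutation group `S_n⁺`. -/
structure IsMagicUnitary (q : Matrix V V A) : Prop where
  selfAdjoint : ∀ i j, IsSelfAdjoint (q i j)
  row_sum : ∀ i, ∑ j, q i j = 1
  col_sum : ∀ i, ∑ j, q j i = 1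
  row_orth : ∀ i j l, q i j * q i l = if j = l then q i j else 0
  col_orth : ∀ i j l, q j i * q l i = if j = l then q j i else 0

/-- The defining relations of Banica's quantum automorphism group `Aut⁺(G)`: a magic unitary that
commutes with the adjacency matrix. -/
structure SatisfiesAut (G : SimpleGraph V) [DecidableRel G.Adj] (q : Matrix V V A) : Prop
    extends IsMagicUnitary q where
  comm_adj : q * G.adjMatrix A = G.adjMatrix A * q

/-- The defining relations of `𝔾_k⁺(G)`: those of `Aut⁺(G)`, together with
`q_{i₁ j₁} ⋯ q_{i_β j_β} = q_{i_β j_β} ⋯ q_{i₁ j₁}` for any two paths `i`, `j` with `β ≤ k + 1`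
vertices, that is, of length at most `k`. -/
structure SatisfiesGk (G : SimpleGraph V) [DecidableRel G.Adj] (k : ℕ) (q : Matrix V V A) : Prop
    extends SatisfiesAut G q where
  reversal : ∀ α ≤ k, ∀ i j : Fin (α + 1) → V, IsPath G i → IsPath G j →
    (entries q i j).prod = (entries q i j).reverse.prod

end Relations

section UniversalAlgebra

universe u

variable {V : Type u} [Fintype V] [DecidableEq V]

/-- A representation of the relations of `𝔾_k⁺(G)` by bounded operators on a nonzero complex
Hilbert space. -/
structure Rep (G : SimpleGraph V) [DecidableRel G.Adj] (k : ℕ) : Type (max u 1) where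
  H : Type
  [normed : NormedAddCommGroup H]
  [inner : InnerProductSpace ℂ H]
  [complete : CompleteSpace H]
  [nontrivial : Nontrivial H]
  q : Matrix V V (H →L[ℂ] H)
  rel : SatisfiesGk G k q

attribute [instance] Rep.normed Rep.inner Rep.complete Rep.nontrivial

variable (G : SimpleGraph V) [DecidableRel G.Adj] (k : ℕ)

/-- The `ℓ^∞`-product of the algebras `B(H)` over all representations of the relations: families
of operators with uniformly bounded norms, with the supremum norm. -/
abbrev RepProd : Type (max u 1) := lp (fun π : Rep G k => π.H →L[ℂ] π.H) ∞

noncomputable instance : CStarAlgebra (RepProd G k) where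

/-- In any representation of the relations the entries `q i j` are contractions. -/
theorem Rep.norm_q_le {G : SimpleGraph V} [DecidableRel G.Adj] {k : ℕ} (π : Rep G k) (i j : V) :
    ‖π.q i j‖ ≤ 1 := by
  have h1 : π.q i j * π.q i j = π.q i j := by simpa using π.rel.row_orth i j j
  have h2 : ‖star (π.q i j) * π.q i j‖ = ‖π.q i j‖ * ‖π.q i j‖ := CStarRing.norm_star_mul_self
  rw [(π.rel.selfAdjoint i j).star_eq, h1] at h2
  nlinarith [norm_nonneg (π.q i j)]

/-- The family `(π(q i j))_π` over all representations `π`. -/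
noncomputable def prodGen (i j : V) : RepProd G k :=
  ⟨fun π => π.q i j, memℓp_infty ⟨1, by rintro _ ⟨π, rfl⟩; exact π.norm_q_le i j⟩⟩

/-- The universal C⋆-algebra `C(𝔾_k⁺(G))` generated by elements `q i j` subject to the relations
`SatisfiesGk G k`, i.e. the completion of the ⋆-algebra generated by the `q i j` in the norm
`‖a‖ = sup ‖π(a)‖`, the supremum being over all representations `π` of the relations. It is realized
as the closed unital ⋆-subalgebra generated by the families `(π(q i j))_π`. Hilbert spaces in `Type`
suffice, as the algebra is separable. -/
noncomputable def subalgebraGk : StarSubalgebra ℂ (RepProd G k) :=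
  (StarAlgebra.adjoin ℂ (Set.range fun x : V × V => prodGen G k x.1 x.2)).topologicalClosure

/-- The type of elements of `C(𝔾_k⁺(G))`. -/
abbrev CGk : Type (max u 1) := subalgebraGk G k

noncomputable instance : CStarAlgebra (CGk G k) :=
  StarSubalgebra.cstarAlgebra _ (h_closed := StarSubalgebra.isClosed_topologicalClosure _)

/-- The matrix of generators of `C(𝔾_k⁺(G))`. -/
noncomputable def gen : Matrix V V (CGk G k) := fun i j =>
  ⟨prodGen G k i j, StarSubalgebra.le_topologicalClosure _
    (StarAlgebra.subset_adjoin ℂ _ ⟨(i, j), rfl⟩)⟩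

variable {G k}

/-- Every representation of the relations extends to a ⋆-homomorphism on `C(𝔾_k⁺(G))`. -/
noncomputable def lift (π : Rep G k) : CGk G k →⋆ₐ[ℂ] (π.H →L[ℂ] π.H) where
  toFun a := a.1 π
  map_one' := rfl
  map_mul' _ _ := rfl
  map_zero' := rfl
  map_add' _ _ := rfl
  commutes' _ := rfl
  map_star' _ := rfl

theorem lift_gen (π : Rep G k) (i j : V) : lift π (gen G k i j) = π.q i j := rfl

/-- An element of `C(𝔾_k⁺(G))` that vanishes in every representation is zero. -/
theorem ext_lift {a b : CGk G k} (h : ∀ π : Rep G k, lift π a = lift π b) : a = b :=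
  Subtype.ext (lp.ext (funext h))

theorem lift_entries (π : Rep G k) {α : ℕ} (i j : Fin (α + 1) → V) :
    (entries (gen G k) i j).map (lift π) = entries π.q i j := by
  simp [entries, List.map_ofFn, Function.comp_def, lift_gen]

variable (G k) in
/-- The generators of `C(𝔾_k⁺(G))` satisfy the defining relations. -/
theorem gen_satisfiesGk : SatisfiesGk G k (gen G k) where
  selfAdjoint i j := ext_lift fun π => by
    rw [map_star, lift_gen]; exact π.rel.selfAdjoint i j
  row_sum i := ext_lift fun π => by
    simpa only [map_sum, lift_gen, map_one] using π.rel.row_sum i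
  col_sum i := ext_lift fun π => by
    simpa only [map_sum, lift_gen, map_one] using π.rel.col_sum i
  row_orth i j l := ext_lift fun π => by
    simpa only [map_mul, lift_gen, apply_ite (lift π), map_zero] using π.rel.row_orth i j l
  col_orth i j l := ext_lift fun π => by
    simpa only [map_mul, lift_gen, apply_ite (lift π), map_zero] using π.rel.col_orth i j l
  comm_adj := by
    refine Matrix.ext fun i j => ext_lift (G := G) (k := k) fun π => ?_
    have h := congrFun (congrFun π.rel.comm_adj i) j
    simpa only [Matrix.mul_apply, SimpleGraph.adjMatrix_apply, map_sum, map_mul, lift_gen,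
      apply_ite (lift π), map_zero, map_one] using h
  reversal α hα i j hi hj := ext_lift fun π => by
    simpa only [map_list_prod, List.map_reverse, lift_entries] using π.rel.reversal α hα i j hi hj

end UniversalAlgebra

section PathCounts

variable {V : Type*} [Fintype V] [DecidableEq V] (G : SimpleGraph V) [DecidableRel G.Adj] (k : ℕ)

/-- The relation `i ∼^k j` between two paths of the same length: `q_{i₀ j₀} ⋯ q_{i_α j_α} ≠ 0` in
`C(𝔾_k⁺(G))`. -/
def PathEquiv {α : ℕ} (i j : Fin (α + 1) → V) : Prop :=
  IsPath G i ∧ IsPath G j ∧ (entries (gen G k) i j).prod ≠ 0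

/-- The relation `∼^k` between two oriented edges, regarded as paths of length one. -/
def EdgeEquiv (e f : G.Dart) : Prop :=
  PathEquiv G k ![e.fst, e.snd] ![f.fst, f.snd]

/-- The set `𝒫_k^{j₁}`, for a set `S` of paths: all paths that start at `j₁` and are
`∼^k`-equivalent to some member of `S`. -/
def pathSet (S : Set (VertexTuple V)) (j₁ : V) : Set (VertexTuple V) :=
  {x | x.2 0 = j₁ ∧ ∃ y : Fin (x.1 + 1) → V, ⟨x.1, y⟩ ∈ S ∧ PathEquiv G k x.2 y}

/-- The number `N_e^k` of paths in the sets `𝒫_k^{j₁}`, `j₁ ∈ V`, in which the unoriented edge `e`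
occurs. -/
noncomputable def edgeCount (S : Set (VertexTuple V)) (e : Sym2 V) : ℕ :=
  {x : VertexTuple V | ∃ j₁, x ∈ pathSet G k S j₁ ∧ EdgeOccurs e x.2}.ncard

/-- The number of paths in the sets `𝒫_k^{j₁}`, `j₁ ∈ V`, that run through the oriented edge `e`
in its direction. -/
noncomputable def orientedEdgeCount (S : Set (VertexTuple V)) (e : V × V) : ℕ :=
  {x : VertexTuple V | ∃ j₁, x ∈ pathSet G k S j₁ ∧ OrientedEdgeOccurs e x.2}.ncard

/-- For shortest paths `S` there are only finitely many paths in the sets `𝒫_k^{j₁}`. -/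
theorem finite_pathSet {S : Set (VertexTuple V)} {i₁ : V}
    (hS : ∀ x ∈ S, IsShortestPathFrom G i₁ x) :
    {x : VertexTuple V | ∃ j₁, x ∈ pathSet G k S j₁}.Finite := by
  have hL : (Set.range fun z : V × V => G.dist z.1 z.2).Finite := Set.finite_range _
  refine (hL.biUnion fun α _ => Set.finite_range fun p : Fin (α + 1) → V =>
    (⟨α, p⟩ : VertexTuple V)).subset ?_
  rintro ⟨α, x⟩ ⟨j₁, -, y, hy, -⟩
  exact Set.mem_biUnion ⟨(y 0, y (Fin.last α)), (hS _ hy).length_eq.symm⟩ ⟨x, rfl⟩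

end PathCounts

end QuantumPaths

open QuantumPaths

/-! On paths of length at most `2 * k + 1`, `∼^k` is an equivalence relation. Symmetry comes from
transposing representations and transitivity from tensoring them. The bound arises because a path
with at most `2 * k + 2` vertices splits into two blocks of at most `k + 1` vertices. On such a
block the reversal relation makes the product self-adjoint, so that it absorbs each of its own
factors (`pairProd_mul_of_mem`).

Let `T` be the set of paths of a fixed length equivalent to members of `S`; it is a union of
classes. Hence the sum of `q_{x₀ z₀} ⋯ q_{x_α z_α}` over `x ∈ T` is `1` or `0` according to whether
`z ∈ T`. Summing also over all `z` with `(z_s, z_{s+1}) = (c, d)` shows that `∑_{x ∈ T} q_{x_s c}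
q_{x_{s+1} d}` is the number of members of `T` crossing `(c, d)` at step `s`. Multiplication by
`q_{ac}` on the left and `q_{bd}` on the right turns this sum into the number crossing `(a, b)`
times `q_{ac} q_{bd}`, so the two numbers agree when `q_{ac} q_{bd} ≠ 0` (`card_through_eq`).

Paths equivalent to shortest paths have distinct vertices, so an edge occurs at most once in each,
and the counts for the separate steps add up to `N_e^k`. -/

namespace QuantumPaths

/-! ### Products of lists in a semiring or monoid. -/

section Lists

theorem prod_ofFn_sum {R V : Type*} [Semiring R] [Fintype V] {n : ℕ} (f : Fin n → V → R) :
    (List.ofFn fun s => ∑ v, f s v).prod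
      = ∑ m : Fin n → V, (List.ofFn fun s => f s (m s)).prod := by
  induction n with
  | zero => simp
  | succ n ih =>
    rw [List.ofFn_succ, List.prod_cons, ih, Finset.sum_mul_sum, ← Finset.sum_product',
      Finset.univ_product_univ]
    refine Fintype.sum_equiv (Fin.consEquiv fun _ => V) _ _ fun x => ?_
    simp [Fin.consEquiv, List.ofFn_succ]

theorem mul_ne_zero_of_prod_ofFn_ne_zero {R : Type*} [Semiring R] {n : ℕ} {f : Fin (n + 1) → R}
    (h : (List.ofFn f).prod ≠ 0) (s : Fin n) : f s.castSucc * f s.succ ≠ 0 := by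
  induction n with
  | zero => exact s.elim0
  | succ n ih =>
    rw [List.ofFn_succ, List.prod_cons] at h
    cases s using Fin.cases with
    | zero =>
      rw [List.ofFn_succ, List.prod_cons, ← mul_assoc] at h
      exact left_ne_zero_of_mul h
    | succ s => exact ih (right_ne_zero_of_mul h) s

theorem prod_ofFn_eq_mul {R : Type*} [Monoid R] {n : ℕ} {f : Fin (n + 1) → R} (s : Fin n)
    (h : ∀ t, t ≠ s.castSucc → t ≠ s.succ → f t = 1) :
    (List.ofFn f).prod = f s.castSucc * f s.succ := by
  induction n with
  | zero => exact s.elim0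
  | succ n ih =>
    rw [List.ofFn_succ, List.prod_cons]
    cases s using Fin.cases with
    | zero =>
      have h1 : (fun i : Fin n => f i.succ.succ) = fun _ => 1 := by
        funext i
        exact h _ (by simp [Fin.ext_iff]) (by simp [Fin.ext_iff])
      rw [List.ofFn_succ, List.prod_cons, h1]
      simp
    | succ s =>
      rw [h 0 (by simp [Fin.ext_iff]) (by simp [Fin.ext_iff]), one_mul,
        ih s fun t h1 h2 => h _ (by simpa [Fin.ext_iff] using h1) (by simpa [Fin.ext_iff] using h2)]
      rfl

theorem prod_ofFn_mul {R : Type*} [Monoid R] {n : ℕ} {f g : Fin n → R}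
    (h : ∀ s t, Commute (f s) (g t)) :
    (List.ofFn fun s => f s * g s).prod = (List.ofFn f).prod * (List.ofFn g).prod := by
  induction n with
  | zero => simp
  | succ n ih =>
    have hc : Commute (List.ofFn fun s : Fin n => f s.succ).prod (g 0) :=
      Commute.list_prod_left _ _ fun x hx => by
        obtain ⟨s, rfl⟩ := (List.mem_ofFn' _ _).1 hx
        exact h _ _
    simp only [List.ofFn_succ, List.prod_cons]
    rw [ih fun s t => h _ _, mul_assoc, mul_assoc, ← mul_assoc (g 0), ← hc.eq, mul_assoc]

theorem star_list_prod {R : Type*} [Monoid R] [StarMul R] (L : List R) :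
    star L.prod = (L.map star).reverse.prod := by
  induction L with
  | nil => simp
  | cons a L ih => simp [ih]

end Lists

/-! ### Words in the entries of a matrix, indexed by lists of pairs. -/

variable {V : Type*} {A : Type*}

/-- The product `q_{i₁ j₁} ⋯ q_{i_β j_β}` along a list of pairs `(i_s, j_s)`. -/
def pairProd [Monoid A] (q : Matrix V V A) (L : List (V × V)) : A :=
  (L.map fun p => q p.1 p.2).prod

/-- Two successive pairs `(i, j)`, `(i', j')` on a pair of paths: both coordinates are adjacent. -/
def PairAdj (G : SimpleGraph V) (p p' : V × V) : Prop := G.Adj p.1 p'.1 ∧ G.Adj p.2 p'.2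

/-- The list of pairs `(i_s, j_s)` of two tuples. -/
def pairs {α : ℕ} (i j : Fin (α + 1) → V) : List (V × V) := List.ofFn fun s => (i s, j s)

theorem entries_prod_eq_pairProd [Monoid A] (q : Matrix V V A) {α : ℕ} (i j : Fin (α + 1) → V) :
    (entries q i j).prod = pairProd q (pairs i j) := by
  simp [entries, pairProd, pairs, List.map_ofFn, Function.comp_def]

theorem pairProd_append [Monoid A] (q : Matrix V V A) (L M : List (V × V)) :
    pairProd q (L ++ M) = pairProd q L * pairProd q M := by
  simp [pairProd]

theorem pairProd_cons [Monoid A] (q : Matrix V V A) (p : V × V) (L : List (V × V)) :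
    pairProd q (p :: L) = q p.1 p.2 * pairProd q L := by
  simp [pairProd]

theorem commute_pairProd [Monoid A] {q r : Matrix V V A}
    (hc : ∀ i j k l, Commute (q i j) (r k l)) (L M : List (V × V)) :
    Commute (pairProd q L) (pairProd r M) := by
  refine Commute.list_prod_left _ _ fun x hx => Commute.list_prod_right _ _ fun y hy => ?_
  obtain ⟨p, -, rfl⟩ := List.mem_map.1 hx
  obtain ⟨p', -, rfl⟩ := List.mem_map.1 hy
  exact hc _ _ _ _

theorem isChain_pairs {G : SimpleGraph V} {α : ℕ} {i j : Fin (α + 1) → V} (hi : IsPath G i)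
    (hj : IsPath G j) : (pairs i j).IsChain (PairAdj G) := by
  rw [pairs, List.isChain_ofFn]
  intro s hs
  exact ⟨hi ⟨s, by omega⟩, hj ⟨s, by omega⟩⟩

variable [Fintype V] [DecidableEq V] [Ring A] [StarRing A]

/-! ### Transposes and commuting products of magic unitaries. -/

namespace IsMagicUnitary

variable {q r : Matrix V V A}

theorem transpose (h : IsMagicUnitary q) : IsMagicUnitary q.transpose where
  selfAdjoint i j := h.selfAdjoint j i
  row_sum := h.col_sum
  col_sum := h.row_sum
  row_orth := h.col_orth
  col_orth := h.row_orth

theorem star_pairProd (h : IsMagicUnitary q) (L : List (V × V)) :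
    star (pairProd q L) = pairProd q L.reverse := by
  rw [pairProd, star_list_prod, pairProd, List.map_map, List.map_reverse]
  congr 2
  exact List.map_congr_left fun p _ => (h.selfAdjoint p.1 p.2).star_eq

theorem star_entries_prod (h : IsMagicUnitary q) {α : ℕ} (i j : Fin (α + 1) → V) :
    star (entries q i j).prod = (entries q i j).reverse.prod := by
  rw [entries_prod_eq_pairProd, h.star_pairProd, pairProd, List.map_reverse]
  simp [entries, pairs, List.map_ofFn, Function.comp_def]

/-- Concrete form of the comultiplication `q_{ij} ↦ ∑ₘ q_{im} ⊗ q_{mj}`; commutation of the entries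
replaces the tensor legs. -/
theorem mul (hq : IsMagicUnitary q) (hr : IsMagicUnitary r)
    (hc : ∀ i j k l, Commute (q i j) (r k l)) : IsMagicUnitary (q * r) where
  selfAdjoint i j := by
    rw [Matrix.mul_apply]
    refine isSelfAdjoint_sum _ fun m _ => ?_
    rw [isSelfAdjoint_iff, star_mul, hq.selfAdjoint, hr.selfAdjoint, hc]
  row_sum i := by
    simp only [Matrix.mul_apply]
    rw [Finset.sum_comm]
    simp [← Finset.mul_sum, hr.row_sum, hq.row_sum]
  col_sum i := by
    simp only [Matrix.mul_apply]
    rw [Finset.sum_comm]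
    simp [← Finset.sum_mul, hr.col_sum, hq.col_sum]
  row_orth i j l := by
    simp only [Matrix.mul_apply, Finset.sum_mul_sum]
    have h (m n : V) : q i m * r m j * (q i n * r n l)
        = if m = n then (if j = l then q i m * r m j else 0) else 0 := by
      rw [mul_assoc, ← mul_assoc (r m j), ← (hc i n m j).eq, mul_assoc, ← mul_assoc,
        hq.row_orth]
      split_ifs with h1 h2
      · subst h1; rw [hr.row_orth, if_pos h2]
      · subst h1; rw [hr.row_orth, if_neg h2, mul_zero]
      · rw [zero_mul]
    simp only [h, Finset.sum_ite_eq, Finset.mem_univ, if_true]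
    split_ifs <;> simp
  col_orth i j l := by
    simp only [Matrix.mul_apply, Finset.sum_mul_sum]
    have h (m n : V) : q j m * r m i * (q l n * r n i)
        = if m = n then (if j = l then q j m * r m i else 0) else 0 := by
      rw [mul_assoc, ← mul_assoc (r m i), ← (hc l n m i).eq, mul_assoc, ← mul_assoc,
        hr.col_orth]
      split_ifs with h1 h2
      · subst h1; rw [hq.col_orth, if_pos h2]
      · subst h1; rw [hq.col_orth, if_neg h2, zero_mul]
      · rw [mul_zero]
    simp only [h, Finset.sum_ite_eq, Finset.mem_univ, if_true]
    split_ifs <;> simp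

end IsMagicUnitary

namespace SatisfiesAut

variable {G : SimpleGraph V} [DecidableRel G.Adj] {q r : Matrix V V A}

theorem transpose (h : SatisfiesAut G q) : SatisfiesAut G q.transpose where
  toIsMagicUnitary := h.toIsMagicUnitary.transpose
  comm_adj := by
    ext i j
    have h1 := congrFun (congrFun h.comm_adj j) i
    simp only [Matrix.mul_apply, SimpleGraph.adjMatrix_apply, Matrix.transpose_apply,
      mul_ite, mul_one, mul_zero, ite_mul, one_mul, zero_mul, G.adj_comm] at h1 ⊢
    exact h1.symm

theorem mul (hq : SatisfiesAut G q) (hr : SatisfiesAut G r)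
    (hc : ∀ i j k l, Commute (q i j) (r k l)) : SatisfiesAut G (q * r) where
  toIsMagicUnitary := hq.toIsMagicUnitary.mul hr.toIsMagicUnitary hc
  comm_adj := by
    rw [Matrix.mul_assoc, hr.comm_adj, ← Matrix.mul_assoc, hq.comm_adj, Matrix.mul_assoc]

/-- Compress the `(a, d)` entry of `qε = εq` between `q a b` and `q c d`. Orthogonality leaves
`ε_{bd} q_{ab} q_{cd} = ε_{ac} q_{ab} q_{cd}`. -/
theorem adj_iff_adj_of_mul_ne_zero (hq : SatisfiesAut G q) {a b c d : V}
    (h : q a b * q c d ≠ 0) : G.Adj a c ↔ G.Adj b d := by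
  have h1 := congrArg (fun x => q a b * x * q c d) (congrFun (congrFun hq.comm_adj a) d)
  have h2 : q a b * ∑ x, q a x * G.adjMatrix A x d = q a b * G.adjMatrix A b d := by
    simp only [Finset.mul_sum, ← mul_assoc, hq.row_orth, ite_mul, zero_mul, Finset.sum_ite_eq,
      Finset.mem_univ, if_true]
  have h3 : (∑ x, G.adjMatrix A a x * q x d) * q c d = G.adjMatrix A a c * q c d := by
    simp only [Finset.sum_mul, mul_assoc, hq.col_orth, mul_ite, mul_zero]
    simp +contextual
  simp only [Matrix.mul_apply] at h1
  rw [h2, mul_assoc (q a b) (∑ x, G.adjMatrix A a x * q x d), h3] at h1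
  by_cases h2 : G.Adj a c <;> by_cases h3 : G.Adj b d <;> simp_all

theorem isPath_iff_isPath (hq : SatisfiesAut G q) {α : ℕ} {i j : Fin (α + 1) → V}
    (h : (entries q i j).prod ≠ 0) : IsPath G i ↔ IsPath G j :=
  forall_congr' fun s =>
    hq.adj_iff_adj_of_mul_ne_zero (mul_ne_zero_of_prod_ofFn_ne_zero h s)

end SatisfiesAut

/-! ### Consequences of the reversal relation, up to length `2 * k + 1`. -/

namespace SatisfiesGk

variable {G : SimpleGraph V} [DecidableRel G.Adj] {k : ℕ} {q r : Matrix V V A}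

theorem transpose (h : SatisfiesGk G k q) : SatisfiesGk G k q.transpose where
  toSatisfiesAut := h.toSatisfiesAut.transpose
  reversal α hα i j hi hj := h.reversal α hα j i hj hi

theorem mul (hq : SatisfiesGk G k q) (hr : SatisfiesGk G k r)
    (hc : ∀ i j k l, Commute (q i j) (r k l)) : SatisfiesGk G k (q * r) where
  toSatisfiesAut := hq.toSatisfiesAut.mul hr.toSatisfiesAut hc
  reversal α hα i j hi hj := by
    have hsum : (entries (q * r) i j).prod
        = ∑ m : Fin (α + 1) → V, (entries q i m).prod * (entries r m j).prod := by
      simp only [entries, Matrix.mul_apply]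
      rw [prod_ofFn_sum]
      refine Finset.sum_congr rfl fun m _ => ?_
      exact prod_ofFn_mul fun s t => (hc _ _ _ _)
    rw [← (hq.toIsMagicUnitary.mul hr.toIsMagicUnitary hc).star_entries_prod, hsum, star_sum]
    refine Finset.sum_congr rfl fun m _ => ?_
    have h0 : star ((entries q i m).prod * (entries r m j).prod)
        = star (entries q i m).prod * star (entries r m j).prod := by
      rw [star_mul, ← star_mul, entries_prod_eq_pairProd, entries_prod_eq_pairProd,
        (commute_pairProd hc _ _).eq, star_mul]
    rw [h0]
    -- The sum runs over all tuples `m`, but a nonvanishing factor forces `m` to be a path, to which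
    -- the reversal relations apply.
    by_cases h : (entries q i m).prod = 0
    · simp [h]
    · have hm := (hq.isPath_iff_isPath h).1 hi
      rw [hq.star_entries_prod, hr.star_entries_prod, ← hq.reversal α hα _ _ hi hm,
        ← hr.reversal α hα _ _ hm hj]

/-- The adjoint reverses a word in self-adjoint letters, so the reversal relation is
self-adjointness of the word. -/
theorem isSelfAdjoint_pairProd (hq : SatisfiesGk G k q) {L : List (V × V)}
    (hL : L.IsChain (PairAdj G)) (hk : L.length ≤ k + 1) : IsSelfAdjoint (pairProd q L) := by
  cases L with
  | nil => simp [pairProd]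
  | cons p L =>
    rw [List.isChain_iff_getElem] at hL
    have h1 := hq.reversal L.length (by simpa using hk) (fun s => ((p :: L).get s).1)
      (fun s => ((p :: L).get s).2) (fun s => (hL s (by simp)).1) (fun s => (hL s (by simp)).2)
    rw [← hq.star_entries_prod, entries_prod_eq_pairProd] at h1
    have h2 : pairs (fun s : Fin (L.length + 1) => ((p :: L).get s).1)
        (fun s => ((p :: L).get s).2) = p :: L := List.ofFn_get (p :: L)
    rw [h2] at h1
    exact h1.symm

/-- With `L = M ++ p :: N`, both `L` and its prefix `M ++ [p]` give self-adjoint words. Taking the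
adjoint of the whole therefore moves the prefix, unreversed, to the right end, where the last letter
is the idempotent of `p`. -/
theorem pairProd_mul_of_mem (hq : SatisfiesGk G k q) {L : List (V × V)}
    (hL : L.IsChain (PairAdj G)) (hk : L.length ≤ k + 1) {p : V × V} (hp : p ∈ L) :
    pairProd q L * q p.1 p.2 = pairProd q L := by
  obtain ⟨M, N, rfl⟩ := List.append_of_mem hp
  have h1 := hq.isSelfAdjoint_pairProd hL hk
  have h2 : IsSelfAdjoint (pairProd q (M ++ [p])) := by
    rw [List.append_cons] at hL hk
    rw [List.length_append] at hk
    exact hq.isSelfAdjoint_pairProd hL.left_of_append (by omega)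
  have h3 : pairProd q (M ++ p :: N) = pairProd q N.reverse * (pairProd q M * q p.1 p.2) := by
    rw [← h1.star_eq, List.append_cons, pairProd_append, star_mul, h2.star_eq,
      hq.star_pairProd, pairProd_append, pairProd_cons]
    simp [pairProd]
  rw [h3, mul_assoc, mul_assoc, hq.row_orth, if_pos rfl]

theorem mul_pairProd_of_mem (hq : SatisfiesGk G k q) {L : List (V × V)}
    (hL : L.IsChain (PairAdj G)) (hk : L.length ≤ k + 1) {p : V × V} (hp : p ∈ L) :
    q p.1 p.2 * pairProd q L = pairProd q L := by
  have h := congrArg star (hq.pairProd_mul_of_mem hL hk hp)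
  rwa [star_mul, (hq.selfAdjoint _ _).star_eq, (hq.isSelfAdjoint_pairProd hL hk).star_eq] at h

/-- Cut the word after `k + 1` letters. Letters of the left block can be duplicated at its right end
and letters of the right block at its left end, so any two letters can be made adjacent at the cut.
-/
theorem mul_ne_zero_of_mem (hq : SatisfiesGk G k q) {L : List (V × V)}
    (hL : L.IsChain (PairAdj G)) (hk : L.length ≤ 2 * k + 2) (h : pairProd q L ≠ 0)
    {p p' : V × V} (hp : p ∈ L) (hp' : p' ∈ L) : q p.1 p.2 * q p'.1 p'.2 ≠ 0 := by
  intro h0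
  have h0' : q p'.1 p'.2 * q p.1 p.2 = 0 := by
    have := congrArg star h0
    rwa [star_mul, star_zero, (hq.selfAdjoint _ _).star_eq, (hq.selfAdjoint _ _).star_eq] at this
  have ht : (L.take (k + 1)).length ≤ k + 1 := List.length_take_le _ _
  have hd : (L.drop (k + 1)).length ≤ k + 1 := by rw [List.length_drop]; omega
  have hr {p : V × V} := hq.pairProd_mul_of_mem (hL.take (k + 1)) ht (p := p)
  have hl {p : V × V} := hq.mul_pairProd_of_mem (hL.drop (k + 1)) hd (p := p)
  rw [← List.take_append_drop (k + 1) L] at h hp hp'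
  rw [pairProd_append] at h
  rw [List.mem_append] at hp hp'
  apply h
  rcases hp with hp | hp <;> rcases hp' with hp' | hp'
  · rw [← hr hp', ← hr hp, mul_assoc (pairProd q _), h0, mul_zero, zero_mul]
  · rw [← hr hp, ← hl hp', mul_assoc (pairProd q _), ← mul_assoc (q _ _), h0, zero_mul, mul_zero]
  · rw [← hr hp', ← hl hp, mul_assoc (pairProd q _), ← mul_assoc (q _ _), h0', zero_mul, mul_zero]
  · rw [← hl hp', ← hl hp, ← mul_assoc (q _ _), h0', zero_mul, mul_zero]

theorem injective_of_prod_ne_zero (hq : SatisfiesGk G k q) {α : ℕ} (hα : α ≤ 2 * k + 1)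
    {i j : Fin (α + 1) → V} (hi : IsPath G i) (hj : IsPath G j) (h : (entries q i j).prod ≠ 0)
    (hinj : Function.Injective j) : Function.Injective i := by
  intro s t hst
  rw [entries_prod_eq_pairProd] at h
  have hmem (s) : (i s, j s) ∈ pairs i j := (List.mem_ofFn' _ _).2 ⟨s, rfl⟩
  have h1 := hq.mul_ne_zero_of_mem (isChain_pairs hi hj) (by simp [pairs]; omega) h
    (hmem s) (hmem t)
  by_contra hne
  simp [hst, hq.row_orth, hinj.ne hne] at h1

/-- The list records triples `(i_s, j_s, l_s)`. In `∑ₘ q_{i_s m} r_{m l_s}` only `m = j_s` survives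
next to `X`, because `X` absorbs `q_{i_s j_s}`; that one term is absorbed by `X * Y`. -/
theorem pairProd_mul_pairProd_mul (hq : SatisfiesGk G k q) (hr : SatisfiesGk G k r)
    (hc : ∀ i j k l, Commute (q i j) (r k l)) {L : List (V × V × V)}
    (hL : (L.map fun p => (p.1, p.2.1)).IsChain (PairAdj G))
    (hL' : (L.map fun p => p.2).IsChain (PairAdj G)) (hk : L.length ≤ k + 1) :
    pairProd q (L.map fun p => (p.1, p.2.1)) * pairProd r (L.map fun p => p.2)
        * pairProd (q * r) (L.map fun p => (p.1, p.2.2))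
      = pairProd q (L.map fun p => (p.1, p.2.1)) * pairProd r (L.map fun p => p.2) := by
  set X := pairProd q (L.map fun p => (p.1, p.2.1))
  set Y := pairProd r (L.map fun p => p.2)
  have key {p : V × V × V} (hp : p ∈ L) : X * Y * (q * r) p.1 p.2.2 = X * Y := by
    have hX : X * q p.1 p.2.1 = X := hq.pairProd_mul_of_mem hL (by simpa using hk)
      (List.mem_map_of_mem (f := fun p : V × V × V => (p.1, p.2.1)) hp)
    have hY : Y * r p.2.1 p.2.2 = Y := hr.pairProd_mul_of_mem hL' (by simpa using hk)
      (List.mem_map_of_mem (f := fun p : V × V × V => p.2) hp)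
    have h1 (m : V) : X * Y * (q p.1 m * r m p.2.2) = if p.2.1 = m then X * Y else 0 := by
      have h2 : X * Y * (q p.1 m * r m p.2.2) = X * q p.1 m * (Y * r m p.2.2) := by
        have h3 : Commute (q p.1 m) Y := by
          have := commute_pairProd hc [(p.1, m)] (L.map fun p => p.2)
          rwa [pairProd_cons, pairProd, List.map_nil, List.prod_nil, mul_one] at this
        rw [mul_assoc, ← mul_assoc Y, ← h3.eq, mul_assoc, mul_assoc]
      rw [h2]
      nth_rewrite 1 [← hX]
      rw [mul_assoc X, hq.row_orth]
      split_ifs with h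
      · subst h; rw [hY, hX]
      · rw [mul_zero, zero_mul]
    simp [Matrix.mul_apply, Finset.mul_sum, h1]
  have main : ∀ M ⊆ L, X * Y * pairProd (q * r) (M.map fun p => (p.1, p.2.2)) = X * Y := by
    intro M
    induction M with
    | nil => simp [pairProd]
    | cons p M ih =>
      intro hM
      rw [List.map_cons, pairProd_cons, ← mul_assoc, key (hM List.mem_cons_self),
        ih fun x hx => hM (List.mem_cons_of_mem _ hx)]
  exact main L fun _ h => h

theorem mul_pairProd_mul_pairProd (hq : SatisfiesGk G k q) (hr : SatisfiesGk G k r)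
    (hc : ∀ i j k l, Commute (q i j) (r k l)) {L : List (V × V × V)}
    (hL : (L.map fun p => (p.1, p.2.1)).IsChain (PairAdj G))
    (hL' : (L.map fun p => p.2).IsChain (PairAdj G)) (hk : L.length ≤ k + 1) :
    pairProd (q * r) (L.map fun p => (p.1, p.2.2))
        * (pairProd q (L.map fun p => (p.1, p.2.1)) * pairProd r (L.map fun p => p.2))
      = pairProd q (L.map fun p => (p.1, p.2.1)) * pairProd r (L.map fun p => p.2) := by
  have hL'' : (L.map fun p => (p.1, p.2.2)).IsChain (PairAdj G) := by
    rw [List.isChain_map] at hL hL' ⊢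
    rw [List.isChain_iff_getElem] at *
    exact fun s hs => ⟨(hL s hs).1, (hL' s hs).2⟩
  have h := congrArg star (hq.pairProd_mul_pairProd_mul hr hc hL hL' hk)
  rwa [star_mul, ((hq.mul hr hc).isSelfAdjoint_pairProd hL'' (by simpa using hk)).star_eq, star_mul,
    (hq.isSelfAdjoint_pairProd hL (by simpa using hk)).star_eq,
    (hr.isSelfAdjoint_pairProd hL' (by simpa using hk)).star_eq,
    ← (commute_pairProd hc _ _).eq] at h

/-- Cutting into two blocks, `X₁X₂Y₁Y₂ = (X₁Y₁)(X₂Y₂)`. The first factor absorbs the first block of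
the `q * r` word on its right and the second factor absorbs the second block on its left, so the
whole `q * r` word can be inserted in the middle. -/
theorem entries_mul_prod_ne_zero (hq : SatisfiesGk G k q) (hr : SatisfiesGk G k r)
    (hc : ∀ i j k l, Commute (q i j) (r k l)) {α : ℕ} (hα : α ≤ 2 * k + 1)
    {i j l : Fin (α + 1) → V} (hi : IsPath G i) (hj : IsPath G j) (hl : IsPath G l)
    (h : (entries q i j).prod * (entries r j l).prod ≠ 0) : (entries (q * r) i l).prod ≠ 0 := by
  set L : List (V × V × V) := List.ofFn fun s => (i s, j s, l s) with hLdef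
  have e1 : pairs i j = L.map fun p => (p.1, p.2.1) := by
    simp [pairs, hLdef, List.map_ofFn, Function.comp_def]
  have e2 : pairs j l = L.map fun p => p.2 := by
    simp [pairs, hLdef, List.map_ofFn, Function.comp_def]
  have e3 : pairs i l = L.map fun p => (p.1, p.2.2) := by
    simp [pairs, hLdef, List.map_ofFn, Function.comp_def]
  have hL1 := isChain_pairs hi hj
  have hL2 := isChain_pairs hj hl
  have hlen : L.length = α + 1 := by simp [hLdef]
  rw [entries_prod_eq_pairProd, entries_prod_eq_pairProd] at h
  rw [entries_prod_eq_pairProd]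
  rw [e1] at h hL1
  rw [e2] at h hL2
  rw [e3]
  clear_value L
  rw [← List.take_append_drop (k + 1) L] at h hL1 hL2 ⊢
  have ht : (L.take (k + 1)).length ≤ k + 1 := List.length_take_le _ _
  have hd : (L.drop (k + 1)).length ≤ k + 1 := by rw [List.length_drop]; omega
  simp only [List.map_append, pairProd_append] at h hL1 hL2 ⊢
  have h1 := hq.pairProd_mul_pairProd_mul hr hc hL1.left_of_append hL2.left_of_append ht
  have h2 := hq.mul_pairProd_mul_pairProd hr hc hL1.right_of_append hL2.right_of_append hd
  intro h0
  apply h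
  rw [mul_assoc, ← mul_assoc (pairProd q (List.map _ (List.drop (k + 1) L))),
    (commute_pairProd hc _ _).eq, mul_assoc, ← mul_assoc, ← h1, ← h2, ← mul_assoc,
    mul_assoc _ _ (pairProd (q * r) _), h0]
  simp

end SatisfiesGk

end QuantumPaths

namespace QuantumPaths

/-! ### Operators on the Hilbert space tensor product. -/

section Tensor

open TensorProduct UniformSpace

theorem completion_op_ext {E : Type*} [NormedAddCommGroup E] [InnerProductSpace ℂ E]
    {S T : Completion E →L[ℂ] Completion E} (h : ∀ x : E, S x = T x) : S = T := by
  ext x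
  induction x using Completion.induction_on with
  | hp => exact isClosed_eq (by fun_prop) (by fun_prop)
  | ih x => exact h x

theorem star_completion_eq {E : Type*} [NormedAddCommGroup E] [InnerProductSpace ℂ E]
    {S T : E →L[ℂ] E} (h : ∀ x y, inner ℂ (S x) y = inner ℂ x (T y)) :
    S.completion = star T.completion := by
  rw [ContinuousLinearMap.star_eq_adjoint, ContinuousLinearMap.eq_adjoint_iff]
  intro x y
  induction x, y using Completion.induction_on₂ with
  | hp => exact isClosed_eq (by fun_prop) (by fun_prop)
  | ih x y => simp [h]

variable (H K : Type*) [NormedAddCommGroup H] [InnerProductSpace ℂ H]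
  [NormedAddCommGroup K] [InnerProductSpace ℂ K]

/-- The Hilbert space tensor product. -/
abbrev HilbertTensor : Type _ := Completion (H ⊗[ℂ] K)

/-- The ⋆-homomorphism `T ↦ T ⊗ 1` into the operators on the Hilbert space tensor product. -/
noncomputable def tensorLeft [CompleteSpace H] :
    (H →L[ℂ] H) →⋆ₐ[ℂ] (HilbertTensor H K →L[ℂ] HilbertTensor H K) where
  toFun T := (T.rTensor K).completion
  map_one' := completion_op_ext fun x => by simp
  map_mul' S T := completion_op_ext fun x => by simp [ContinuousLinearMap.rTensor_mul]
  map_zero' := completion_op_ext fun x => by simp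
  map_add' S T := completion_op_ext fun x => by simpa using Completion.coe_add _ _
  commutes' c := completion_op_ext fun x => by simp [Algebra.algebraMap_eq_smul_one]
  map_star' T := by
    refine star_completion_eq fun x y => ?_
    induction x with
    | zero => simp
    | add a b ha hb => simp only [map_add, inner_add_left, ha, hb]
    | tmul a b =>
      induction y with
      | zero => simp
      | add c d hc hd => simp only [map_add, inner_add_right, hc, hd]
      | tmul c d =>
        simp [ContinuousLinearMap.star_eq_adjoint, ContinuousLinearMap.adjoint_inner_left]

/-- The ⋆-homomorphism `T ↦ 1 ⊗ T` into the operators on the Hilbert space tensor product. -/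
noncomputable def tensorRight [CompleteSpace K] :
    (K →L[ℂ] K) →⋆ₐ[ℂ] (HilbertTensor H K →L[ℂ] HilbertTensor H K) where
  toFun T := (T.lTensor H).completion
  map_one' := completion_op_ext fun x => by simp
  map_mul' S T := completion_op_ext fun x => by simp [ContinuousLinearMap.lTensor_mul]
  map_zero' := completion_op_ext fun x => by simp
  map_add' S T := completion_op_ext fun x => by simpa using Completion.coe_add _ _
  commutes' c := completion_op_ext fun x => by simp [Algebra.algebraMap_eq_smul_one]
  map_star' T := by
    refine star_completion_eq fun x y => ?_
    induction x with
    | zero => simp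
    | add a b ha hb => simp only [map_add, inner_add_left, ha, hb]
    | tmul a b =>
      induction y with
      | zero => simp
      | add c d hc hd => simp only [map_add, inner_add_right, hc, hd]
      | tmul c d =>
        simp [ContinuousLinearMap.star_eq_adjoint, ContinuousLinearMap.adjoint_inner_left]

variable {H K} [CompleteSpace H] [CompleteSpace K]

theorem tensorLeft_mul_tensorRight_apply (S : H →L[ℂ] H) (T : K →L[ℂ] K) (h : H) (k : K) :
    (tensorLeft H K S * tensorRight H K T) ((h ⊗ₜ k : H ⊗[ℂ] K) : Completion (H ⊗[ℂ] K))
      = ((S h ⊗ₜ T k : H ⊗[ℂ] K) : Completion (H ⊗[ℂ] K)) := by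
  simp [tensorLeft, tensorRight]

theorem commute_tensorLeft_tensorRight (S : H →L[ℂ] H) (T : K →L[ℂ] K) :
    Commute (tensorLeft H K S) (tensorRight H K T) := by
  refine completion_op_ext fun x => ?_
  have h : S.rTensor K (T.lTensor H x) = T.lTensor H (S.rTensor K x) := by
    rw [← ContinuousLinearMap.comp_apply, ← ContinuousLinearMap.comp_apply,
      ContinuousLinearMap.rTensor_comp_lTensor, ContinuousLinearMap.lTensor_comp_rTensor]
  simpa [tensorLeft, tensorRight] using h

/-- The norm is multiplicative on simple tensors, so `S h ⊗ T k ≠ 0` when `S h` and `T k` are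
nonzero. -/
theorem tensorLeft_mul_tensorRight_ne_zero {S : H →L[ℂ] H} {T : K →L[ℂ] K} (hS : S ≠ 0)
    (hT : T ≠ 0) : tensorLeft H K S * tensorRight H K T ≠ 0 := by
  obtain ⟨h, hh⟩ := DFunLike.ne_iff.1 hS
  obtain ⟨k, hk⟩ := DFunLike.ne_iff.1 hT
  intro h0
  have h1 := congrArg norm (tensorLeft_mul_tensorRight_apply S T h k)
  rw [h0] at h1
  simp_all

end Tensor

/-! ### Transport of the relations along ⋆-homomorphisms. -/

section Map

variable {V A B : Type*} [Ring A] [StarRing A] [Algebra ℂ A] [Ring B] [StarRing B] [Algebra ℂ B]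
  {q : Matrix V V A}

theorem entries_map_prod (φ : A →⋆ₐ[ℂ] B) {α : ℕ} (i j : Fin (α + 1) → V) :
    (entries (q.map φ) i j).prod = φ (entries q i j).prod := by
  rw [map_list_prod]
  simp [entries, List.map_ofFn, Function.comp_def]

variable [Fintype V] [DecidableEq V] {G : SimpleGraph V} [DecidableRel G.Adj] {k : ℕ}

theorem SatisfiesGk.map (hq : SatisfiesGk G k q) (φ : A →⋆ₐ[ℂ] B) : SatisfiesGk G k (q.map φ) where
  selfAdjoint i j := by
    rw [isSelfAdjoint_iff, Matrix.map_apply, ← map_star, (hq.selfAdjoint i j).star_eq]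
  row_sum i := by simp only [Matrix.map_apply, ← map_sum, hq.row_sum, map_one]
  col_sum i := by simp only [Matrix.map_apply, ← map_sum, hq.col_sum, map_one]
  row_orth i j l := by
    simp only [Matrix.map_apply, ← map_mul, hq.row_orth, apply_ite φ, map_zero]
  col_orth i j l := by
    simp only [Matrix.map_apply, ← map_mul, hq.col_orth, apply_ite φ, map_zero]
  comm_adj := by
    ext i j
    have h := congrArg φ (congrFun (congrFun hq.comm_adj i) j)
    simpa only [Matrix.mul_apply, SimpleGraph.adjMatrix_apply, map_sum, map_mul, Matrix.map_apply,
      apply_ite φ, map_zero, map_one] using h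
  reversal α hα i j hi hj := by
    have h := congrArg φ (hq.reversal α hα i j hi hj)
    rw [map_list_prod, map_list_prod, List.map_reverse] at h
    simp only [entries, List.map_ofFn] at h ⊢
    exact h

end Map

-- Symmetry and transitivity of `∼^k`.

universe u

variable {V : Type u} [Fintype V] [DecidableEq V] {G : SimpleGraph V} [DecidableRel G.Adj] {k : ℕ}

theorem lift_entries_prod (π : Rep G k) {α : ℕ} (i j : Fin (α + 1) → V) :
    lift π (entries (gen G k) i j).prod = (entries π.q i j).prod := by
  rw [map_list_prod, lift_entries]

/-- Reduces `∼^k` to single representations, which can be transposed and tensored directly. -/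
theorem entries_gen_prod_ne_zero_iff {α : ℕ} {i j : Fin (α + 1) → V} :
    (entries (gen G k) i j).prod ≠ 0 ↔ ∃ π : Rep G k, (entries π.q i j).prod ≠ 0 := by
  rw [← not_iff_not]
  push Not
  refine ⟨fun h π => by rw [← lift_entries_prod, h, map_zero], fun h => ext_lift fun π => ?_⟩
  rw [lift_entries_prod, h, map_zero]

namespace PathEquiv

variable {α : ℕ} {i j l : Fin (α + 1) → V}

theorem symm (h : PathEquiv G k i j) : PathEquiv G k j i := by
  obtain ⟨hi, hj, h⟩ := h
  obtain ⟨π, hπ⟩ := entries_gen_prod_ne_zero_iff.1 h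
  exact ⟨hj, hi, entries_gen_prod_ne_zero_iff.2
    ⟨{ H := π.H, q := π.q.transpose, rel := π.rel.transpose }, hπ⟩⟩

theorem trans (hα : α ≤ 2 * k + 1) (h : PathEquiv G k i j) (h' : PathEquiv G k j l) :
    PathEquiv G k i l := by
  obtain ⟨hi, hj, h⟩ := h
  obtain ⟨-, hl, h'⟩ := h'
  obtain ⟨π, hπ⟩ := entries_gen_prod_ne_zero_iff.1 h
  obtain ⟨ρ, hρ⟩ := entries_gen_prod_ne_zero_iff.1 h'
  have hne : (entries (π.q.map (tensorLeft π.H ρ.H)) i j).prod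
      * (entries (ρ.q.map (tensorRight π.H ρ.H)) j l).prod ≠ 0 := by
    rw [entries_map_prod (A := π.H →L[ℂ] π.H)
        (B := HilbertTensor π.H ρ.H →L[ℂ] HilbertTensor π.H ρ.H),
      entries_map_prod (A := ρ.H →L[ℂ] ρ.H)
        (B := HilbertTensor π.H ρ.H →L[ℂ] HilbertTensor π.H ρ.H)]
    exact tensorLeft_mul_tensorRight_ne_zero hπ hρ
  have hq := π.rel.map (B := HilbertTensor π.H ρ.H →L[ℂ] HilbertTensor π.H ρ.H)
    (tensorLeft π.H ρ.H)
  have hr := ρ.rel.map (B := HilbertTensor π.H ρ.H →L[ℂ] HilbertTensor π.H ρ.H)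
    (tensorRight π.H ρ.H)
  have hc (a b c d : V) : Commute (π.q.map (tensorLeft π.H ρ.H) a b)
      (ρ.q.map (tensorRight π.H ρ.H) c d) := commute_tensorLeft_tensorRight _ _
  -- `Rep` asks for a nonzero space; a nonzero operator on it is already at hand.
  have : Nontrivial (HilbertTensor π.H ρ.H) := by
    by_contra hsub
    rw [not_nontrivial_iff_subsingleton] at hsub
    exact hne (Subsingleton.elim _ _)
  exact ⟨hi, hl, entries_gen_prod_ne_zero_iff.2
    ⟨{ H := HilbertTensor π.H ρ.H, q := _, rel := hq.mul hr hc },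
      hq.entries_mul_prod_ne_zero hr hc hα hi hj hl hne⟩⟩

end PathEquiv

end QuantumPaths

namespace QuantumPaths

/-! ### Sums of words and the double count. -/

section Sums

variable {V A : Type*} [Fintype V] [DecidableEq V] [Ring A] [StarRing A] {q : Matrix V V A}

theorem IsMagicUnitary.sum_entries_prod (hq : IsMagicUnitary q) {α : ℕ} (z : Fin (α + 1) → V) :
    ∑ x : Fin (α + 1) → V, (entries q x z).prod = 1 := by
  simp only [entries]
  rw [← prod_ofFn_sum fun s v => q v (z s)]
  simp [hq.col_sum]

theorem IsMagicUnitary.sum_entries_prod_through (hq : IsMagicUnitary q) {α : ℕ}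
    (x : Fin (α + 1) → V) (s : Fin α) (c d : V) :
    ∑ z : Fin (α + 1) → V with z s.castSucc = c ∧ z s.succ = d, (entries q x z).prod
      = q (x s.castSucc) c * q (x s.succ) d := by
  -- The constraint on `z` is imposed letter by letter, so that the constrained sum of products
  -- factors into a product of sums; the unconstrained factors are row sums, equal to `1`.
  let f (t : Fin (α + 1)) (v : V) : A :=
    if (t = s.castSucc → v = c) ∧ (t = s.succ → v = d) then q (x t) v else 0
  have hne : s.castSucc ≠ s.succ := (Fin.castSucc_lt_succ).ne
  have h1 (z : Fin (α + 1) → V) :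
      (if z s.castSucc = c ∧ z s.succ = d then (entries q x z).prod else 0)
        = (List.ofFn fun t => f t (z t)).prod := by
    split_ifs with h
    · rw [entries]
      congr 2
      funext t
      refine (if_pos ⟨?_, ?_⟩).symm
      · rintro rfl; exact h.1
      · rintro rfl; exact h.2
    · symm
      by_contra h0
      have h2 := mul_ne_zero_of_prod_ofFn_ne_zero h0 s
      have h3 := left_ne_zero_of_mul h2
      have h4 := right_ne_zero_of_mul h2
      simp only [f, ne_eq, ite_eq_right_iff, not_forall] at h3 h4
      exact h ⟨h3.1.1 trivial, h4.1.2 trivial⟩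
  rw [Finset.sum_filter, Finset.sum_congr rfl fun z _ => h1 z, ← prod_ofFn_sum f,
    prod_ofFn_eq_mul s]
  · simp [f, hne, hne.symm]
  · intro t h2 h3
    simp [f, h2, h3, hq.row_sum]

end Sums

universe u

variable {V : Type u} [Fintype V] [DecidableEq V] {G : SimpleGraph V} [DecidableRel G.Adj] {k : ℕ}

/-- A nonzero term makes `x` and `z` equivalent, hence both in `T` or both outside. For `z ∈ T` the
sum is thus the full sum over all tuples, which is `1`. -/
theorem sum_entries_gen_prod_mem {α : ℕ} {T : Finset (Fin (α + 1) → V)}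
    (hpath : ∀ x ∈ T, IsPath G x) (hT : ∀ x z, PathEquiv G k x z → (x ∈ T ↔ z ∈ T))
    (z : Fin (α + 1) → V) :
    ∑ x ∈ T, (entries (gen G k) x z).prod = if z ∈ T then 1 else 0 := by
  have hA := gen_satisfiesGk G k
  split_ifs with hz
  · rw [← hA.sum_entries_prod z]
    refine Finset.sum_subset (Finset.subset_univ _) fun x _ hx => ?_
    by_contra h
    exact hx ((hT x z ⟨(hA.isPath_iff_isPath h).2 (hpath z hz), hpath z hz, h⟩).2 hz)
  · refine Finset.sum_eq_zero fun x hx => ?_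
    by_contra h
    exact hz ((hT x z ⟨hpath x hx, (hA.isPath_iff_isPath h).1 (hpath x hx), h⟩).1 hx)

theorem card_through_eq {α : ℕ} {T : Finset (Fin (α + 1) → V)}
    (hpath : ∀ x ∈ T, IsPath G x) (hT : ∀ x z, PathEquiv G k x z → (x ∈ T ↔ z ∈ T)) (s : Fin α)
    {a b c d : V} (h : gen G k a c * gen G k b d ≠ 0) :
    (T.filter fun x => x s.castSucc = a ∧ x s.succ = b).card
      = (T.filter fun x => x s.castSucc = c ∧ x s.succ = d).card := by
  have hA := gen_satisfiesGk G k
  set q := gen G k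
  have h1 : ∑ x ∈ T, q (x s.castSucc) c * q (x s.succ) d
      = ((T.filter fun x => x s.castSucc = c ∧ x s.succ = d).card : CGk G k) := by
    rw [Finset.sum_congr rfl fun x _ => (hA.sum_entries_prod_through x s c d).symm,
      Finset.sum_comm, Finset.sum_congr rfl fun z _ => sum_entries_gen_prod_mem hpath hT z]
    rw [Finset.sum_boole, Finset.filter_filter]
    congr 2
    ext x
    simp [and_comm]
  have h2 : q a c * (∑ x ∈ T, q (x s.castSucc) c * q (x s.succ) d) * q b d
      = (T.filter fun x => x s.castSucc = a ∧ x s.succ = b).card * (q a c * q b d) := by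
    rw [Finset.mul_sum, Finset.sum_mul, Finset.card_filter, Nat.cast_sum, Finset.sum_mul]
    refine Finset.sum_congr rfl fun x _ => ?_
    rw [← mul_assoc, hA.col_orth, mul_assoc, hA.col_orth]
    by_cases h3 : x s.castSucc = a
    · by_cases h4 : x s.succ = b
      · rw [if_pos h3.symm, if_pos h4, if_pos ⟨h3, h4⟩, Nat.cast_one, one_mul, h4]
      · rw [if_neg h4, if_neg (c := _ ∧ _) fun h => h4 (And.right h), Nat.cast_zero, zero_mul,
          mul_zero]
    · rw [if_neg (Ne.symm h3), if_neg (c := _ ∧ _) fun h => h3 (And.left h), Nat.cast_zero,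
        zero_mul, zero_mul]
  rw [h1, ← Nat.cast_comm, mul_assoc] at h2
  have h3 := h2.symm
  -- As complex scalars the two counts can be compared by cancelling the nonzero vector `q a c * q b
  -- d`.
  rw [← nsmul_eq_mul, ← nsmul_eq_mul, ← Nat.cast_smul_eq_nsmul ℂ, ← Nat.cast_smul_eq_nsmul ℂ] at h3
  exact Nat.cast_injective (smul_left_injective ℂ h h3)

/-! ### Shortest paths. -/

section Shortest

theorem IsPath.dist_le {V : Type*} {G : SimpleGraph V} (hconn : G.Connected) {α : ℕ}
    {y : Fin (α + 1) → V} (hy : IsPath G y) (a n : ℕ) (h : a + n < α + 1) :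
    G.dist (y ⟨a, by omega⟩) (y ⟨a + n, h⟩) ≤ n := by
  induction n with
  | zero => simp
  | succ n ih =>
    have h1 := ih (by omega)
    have h2 : G.dist (y ⟨a + n, by omega⟩) (y ⟨a + (n + 1), h⟩) = 1 :=
      SimpleGraph.dist_eq_one_iff_adj.2 (hy ⟨a + n, by omega⟩)
    have h3 := hconn.dist_triangle (u := y ⟨a, by omega⟩) (v := y ⟨a + n, by omega⟩)
      (w := y ⟨a + (n + 1), h⟩)
    omega

/-- A repetition at `s < t` would allow a shortcut of length `s + (α - t) < α`. -/
theorem IsShortestPathFrom.injective {V : Type*} {G : SimpleGraph V} (hconn : G.Connected) {i₁ : V}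
    {x : VertexTuple V} (hx : IsShortestPathFrom G i₁ x) : Function.Injective x.2 := by
  obtain ⟨α, y⟩ := x
  have hy : IsPath G y := hx.isPath
  have key (s t : Fin (α + 1)) (hst : s < t) : y s ≠ y t := by
    intro h
    obtain ⟨s, hs⟩ := s
    obtain ⟨t, ht⟩ := t
    have hlt : s < t := hst
    have h1 := hy.dist_le hconn 0 s (by omega)
    have h2 := hy.dist_le hconn t (α - t) (by omega)
    have h3 : α = G.dist (y 0) (y (Fin.last α)) := hx.length_eq
    have h4 := hconn.dist_triangle (u := y 0) (v := y ⟨s, hs⟩) (w := y (Fin.last α))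
    have h5 : (⟨t + (α - t), by omega⟩ : Fin (α + 1)) = Fin.last α :=
      Fin.ext (by simp; omega)
    simp only [h5, zero_add] at h1 h2
    have h6 : (⟨0, by omega⟩ : Fin (α + 1)) = 0 := rfl
    rw [h6] at h1
    rw [← h] at h2
    omega
  intro s t h
  by_contra hne
  rcases lt_or_gt_of_ne hne with h1 | h1
  · exact key _ _ h1 h
  · exact key _ _ h1 h.symm

theorem length_le_of_isShortestPathFrom {V : Type*} [Finite V] {G : SimpleGraph V}
    (hconn : G.Connected) {i₁ : V} {x : VertexTuple V} (hx : IsShortestPathFrom G i₁ x) {n : ℕ}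
    (hdiam : G.diam ≤ n) : x.1 ≤ n := by
  have := hconn.nonempty
  rw [hx.length_eq]
  exact (SimpleGraph.dist_le_diam (SimpleGraph.connected_iff_ediam_ne_top.1 hconn)).trans hdiam

end Shortest

/-! ### Edge counts. -/

section Counts

variable {S : Set (VertexTuple V)} {i₁ : V}

variable (G k S) in
/-- The paths of length `α` that are `∼^k`-equivalent to a member of `S`. -/
noncomputable def equivPaths (α : ℕ) : Finset (Fin (α + 1) → V) :=
  (Set.toFinite {x | ∃ y : Fin (α + 1) → V, ⟨α, y⟩ ∈ S ∧ PathEquiv G k x y}).toFinset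

theorem mem_equivPaths {α : ℕ} {x : Fin (α + 1) → V} :
    x ∈ equivPaths G k S α ↔ ∃ y : Fin (α + 1) → V, ⟨α, y⟩ ∈ S ∧ PathEquiv G k x y := by
  simp [equivPaths]

theorem injective_of_mem_equivPaths (hconn : G.Connected) (hdiam : G.diam ≤ 2 * k + 1)
    (hS : ∀ x ∈ S, IsShortestPathFrom G i₁ x) {α : ℕ} {x : Fin (α + 1) → V}
    (hx : x ∈ equivPaths G k S α) : Function.Injective x := by
  obtain ⟨y, hy, hxp, hyp, hne⟩ := mem_equivPaths.1 hx
  exact (gen_satisfiesGk G k).injective_of_prod_ne_zero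
    (length_le_of_isShortestPathFrom hconn (hS _ hy) hdiam) hxp hyp hne
    ((hS _ hy).injective hconn)

/-- The diameter bound places every member of `S` in the range of lengths where `∼^k` is transitive.
-/
theorem mem_equivPaths_iff_of_pathEquiv (hconn : G.Connected) (hdiam : G.diam ≤ 2 * k + 1)
    (hS : ∀ x ∈ S, IsShortestPathFrom G i₁ x) {α : ℕ} {x z : Fin (α + 1) → V}
    (h : PathEquiv G k x z) : x ∈ equivPaths G k S α ↔ z ∈ equivPaths G k S α := by
  simp only [mem_equivPaths]
  constructor
  · rintro ⟨y, hy, hxy⟩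
    exact ⟨y, hy, h.symm.trans (length_le_of_isShortestPathFrom hconn (hS _ hy) hdiam) hxy⟩
  · rintro ⟨y, hy, hzy⟩
    exact ⟨y, hy, h.trans (length_le_of_isShortestPathFrom hconn (hS _ hy) hdiam) hzy⟩

/-- Sorts the paths by length and by the step at which `e` is crossed; that step is unique because
the vertices are distinct. -/
theorem orientedEdgeCount_eq_card_sigma (hconn : G.Connected) (hdiam : G.diam ≤ 2 * k + 1)
    (hS : ∀ x ∈ S, IsShortestPathFrom G i₁ x) (e : V × V) :
    orientedEdgeCount G k S e = Nat.card (Σ α : ℕ, Σ s : Fin α,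
      {x // x ∈ (equivPaths G k S α).filter fun x => x s.castSucc = e.1 ∧ x s.succ = e.2}) := by
  rw [orientedEdgeCount, ← Nat.card_coe_set_eq]
  symm
  refine Nat.card_congr (Equiv.ofBijective (fun w => ⟨⟨w.1, w.2.2.1⟩, ?_⟩) ⟨?_, ?_⟩)
  · obtain ⟨α, s, x, hx⟩ := w
    rw [Finset.mem_filter, mem_equivPaths] at hx
    exact ⟨x 0, ⟨rfl, hx.1⟩, s, Prod.ext hx.2.1 hx.2.2⟩
  · rintro ⟨α, s, x, hx⟩ ⟨β, t, y, hy⟩ h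
    obtain ⟨rfl, h⟩ := Sigma.mk.inj_iff.1 (Subtype.mk.inj h)
    obtain rfl := eq_of_heq h
    rw [Finset.mem_filter] at hx hy
    have h1 := injective_of_mem_equivPaths hconn hdiam hS hx.1 (hx.2.1.trans hy.2.1.symm)
    obtain rfl := Fin.castSucc_injective _ h1
    rfl
  · rintro ⟨⟨α, x⟩, j₁, ⟨-, hx⟩, s, hs⟩
    have h := Prod.ext_iff.1 hs
    exact ⟨⟨α, s, x, Finset.mem_filter.2 ⟨mem_equivPaths.2 hx, h⟩⟩, rfl⟩

theorem orientedEdgeCount_eq (hconn : G.Connected) (hdiam : G.diam ≤ 2 * k + 1)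
    (hS : ∀ x ∈ S, IsShortestPathFrom G i₁ x) {e f : V × V}
    (h : gen G k e.1 f.1 * gen G k e.2 f.2 ≠ 0) :
    orientedEdgeCount G k S e = orientedEdgeCount G k S f := by
  rw [orientedEdgeCount_eq_card_sigma hconn hdiam hS,
    orientedEdgeCount_eq_card_sigma hconn hdiam hS]
  refine Nat.card_congr (Equiv.sigmaCongrRight fun α => Equiv.sigmaCongrRight fun s => ?_)
  refine Finset.equivOfCardEq (card_through_eq (fun x hx => ?_) (fun x z hxz => ?_) s h)
  · obtain ⟨y, -, hxy⟩ := mem_equivPaths.1 hx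
    exact hxy.1
  · exact mem_equivPaths_iff_of_pathEquiv hconn hdiam hS hxz

theorem edgeCount_eq_add (hconn : G.Connected) (hdiam : G.diam ≤ 2 * k + 1)
    (hS : ∀ x ∈ S, IsShortestPathFrom G i₁ x) (e : G.Dart) :
    edgeCount G k S e.edge
      = orientedEdgeCount G k S e.toProd + orientedEdgeCount G k S e.symm.toProd := by
  have hfin := finite_pathSet G k hS
  have hfin' (p : VertexTuple V → Prop) :
      {x : VertexTuple V | ∃ j₁, x ∈ pathSet G k S j₁ ∧ p x}.Finite :=
    hfin.subset fun x ⟨j, hj, _⟩ => ⟨j, hj⟩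
  rw [edgeCount, orientedEdgeCount, orientedEdgeCount, ← Set.ncard_union_eq ?_ (hfin' _) (hfin' _)]
  · congr 1
    ext x
    have h : EdgeOccurs e.edge x.2
        ↔ OrientedEdgeOccurs e.toProd x.2 ∨ OrientedEdgeOccurs e.symm.toProd x.2 := by
      rw [EdgeOccurs, OrientedEdgeOccurs, OrientedEdgeOccurs, ← exists_or]
      exact exists_congr fun s => by
        simp [SimpleGraph.Dart.edge, Prod.ext_iff]
    simp only [Set.mem_ofPred_eq, Set.mem_union, h, and_or_left, exists_or]
  · rw [Set.disjoint_left]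
    rintro ⟨α, x⟩ ⟨j₁, ⟨-, hx⟩, s, hs⟩ ⟨-, -, t, ht⟩
    have hinj := injective_of_mem_equivPaths hconn hdiam hS (mem_equivPaths.2 hx)
    obtain ⟨h1, h2⟩ := Prod.ext_iff.1 hs
    obtain ⟨h3, h4⟩ := Prod.ext_iff.1 ht
    have h5 := hinj (h1.trans h4.symm)
    have h6 := hinj (h2.trans h3.symm)
    simp only [Fin.ext_iff, Fin.val_castSucc, Fin.val_succ] at h5 h6
    -- Crossing the edge in both directions would give `s = t + 1` and `s + 1 = t`.
    omega

end Counts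

end QuantumPaths

theorem mainTheorem6 {V : Type*} [Fintype V] [DecidableEq V]
    (G : SimpleGraph V) [DecidableRel G.Adj]
    (hconn : G.Connected)
    (htrans : ∀ a b : V, ∃ φ : G ≃g G, φ a = b)
    (k : ℕ) (hdiam : G.diam ≤ 2 * k + 1)
    (i₁ : V) (S : Set (VertexTuple V))
    (hS : ∀ x ∈ S, IsShortestPathFrom G i₁ x)
    (e f : G.Dart) (hef : EdgeEquiv G k e f) :
    edgeCount G k S e.edge = edgeCount G k S f.edge ∧
      orientedEdgeCount G k S e.toProd = orientedEdgeCount G k S f.toProd := by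
  have hA := gen_satisfiesGk G k
  have h : gen G k e.fst f.fst * gen G k e.snd f.snd ≠ 0 := by
    have := hef.2.2
    simp only [entries, List.ofFn_succ, List.ofFn_zero, List.prod_cons, List.prod_nil,
      mul_one] at this
    exact this
  -- Taking adjoints shows that the reversed edges are equivalent too, as the unoriented count
  -- needs.
  have h' : gen G k e.snd f.snd * gen G k e.fst f.fst ≠ 0 := by
    intro h0
    have h1 := congrArg star h0
    rw [star_mul, (hA.selfAdjoint _ _).star_eq, (hA.selfAdjoint _ _).star_eq, star_zero] at h1
    exact h h1
  have h1 := orientedEdgeCount_eq hconn hdiam hS (e := e.toProd) (f := f.toProd) h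
  have h2 := orientedEdgeCount_eq hconn hdiam hS (e := e.symm.toProd) (f := f.symm.toProd) h'
  exact ⟨by rw [edgeCount_eq_add hconn hdiam hS, edgeCount_eq_add hconn hdiam hS, h1, h2], h1⟩
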